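/- Conventions. All ultrafilters are on $\omega$; an ultrafilter is nonprincipal if it contains no singleton. A p-point is a nonprincipal ultrafilter $\mathcal U$ such that for each decreasing sequence $X_0\supseteq X_1\supseteq\cdots$ of members of $\mathcal U$ there is $A\in\mathcal U$ with $A\setminus X_n$ finite for all $n$. The Fubini product of ultrafilters $\mathcal V_n$ over $\mathcal U$ is $\lim_{n\to\mathcal U}\mathcal V_n=\{A\subseteq\omega\times\omega:\{n:\{j:(n,j)\in A\}\in\mathcal V_n\}\in\mathcal U\}$. The Fubini iterates of p-points form the least class of ultrafilters that contains the p-points and contains, whenever $\mathcal U$ is a p-point and all $\mathcal V_n$ are in the class, every copy on $\omega$ of $\lim_{n\to\mathcal U}\mathcal V_n$ under a bijection $\omega\times\omega\to\omega$. A base (cofinal subset) of a filter $\mathcal F$ is a set $\mathcal C\subseteq\mathcal F$ such that each member of $\mathcal F$ contains a member of $\mathcal C$. A map $f:\mathcal F\to\mathcal G$ between filters is cofinal if the image of every base of $\mathcal F$ is a base of $\mathcal G$, and monotone if $X\subseteq Y$ implies $f(X)\subseteq f(Y)$. Write $\mathcal G\le_T\mathcal F$ if there is a cofinal map $\mathcal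 F\to\mathcal G$; $\mathcal F\equiv_T\mathcal G$ if $\mathcal F\le_T\mathcal G\le_T\mathcal F$; and $\mathcal G\le_{RK}\mathcal F$ if there is a map $f$ from the base set of $\mathcal F$ to that of $\mathcal G$ with $\mathcal G=\{Y:f^{-1}(Y)\in\mathcal F\}$. A function $\hat h:[\omega]^{<\omega}\to[\omega]^{<\omega}$ finitely generates $h:\mathcal U\to\mathcal V$ if $s\subseteq t$ implies $\hat h(s)\subseteq\hat h(t)$, and there is a base $\mathcal C$ of $\mathcal U$ such that $h(X)=\bigcup_{k<\omega}\hat h(X\cap k)$ for all $X\in\mathcal C$. For such $\hat h$ let $P=P_{\hat h}$ be the set of all $s\in[\omega]^{<\omega}$ with $\hat h(s)\neq\emptyset$ and $\hat h(t)=\emptyset$ for every proper initial segment $t$ of $s$, and let $\mathcal U(P)$ be the filter on $P$ generated by the sets $\{s\in P:s\subseteq X\}$, $X\in\mathcal U$. Theorem. Let $\mathcal U$ be an ultrafilter on $\omega$ that is Tukey reducible to some Fubini iterate of p-points, and let $\mathcal V\le_T\mathcal U$ be an ultrafilter on $\omega$. Then there is a monotone cofinal map from $\mathcal U$ to $\mathcal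 V$, and for every monotone cofinal map $h:\mathcal U\to\mathcal V$ there is a function $\hat h$ that finitely generates $h$ and satisfies $$\mathcal U(P_{\hat h})\equiv_T\mathcal U\quad\text{and}\quad \mathcal V\le_{RK}\mathcal U(P_{\hat h}).$$ In particular there is a filter $\mathcal U(P)\equiv_T\mathcal U$ with $\mathcal V\le_{RK}\mathcal U(P)$. If moreover $\mathcal V$ is nonprincipal, then the two displayed relations hold for every function $\hat h$ that finitely generates $h$. -/

import Mathlib

namespace TukeyFilters

/-- A filter base of `F`: a cofinal subset of `(F, ⊇)`. -/
def IsBase {α : Type*} (F : Filter α) (C : Set {X : Set α // X ∈ F}) : Prop :=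
  ∀ X ∈ F, ∃ B ∈ C, B.1 ⊆ X

/-- A map from a filter to a filter is cofinal if the image of every filter base is a
filter base. -/
def IsCofinalMap {α β : Type*} (F : Filter α) (G : Filter β)
    (f : {X : Set α // X ∈ F} → {Y : Set β // Y ∈ G}) : Prop :=
  ∀ C : Set {X : Set α // X ∈ F}, IsBase F C → IsBase G (f '' C)

/-- `G ≤_T F`: there is a cofinal map from `F` to `G`. -/
def TukeyLE {α β : Type*} (G : Filter β) (F : Filter α) : Prop :=
  ∃ f : {X : Set α // X ∈ F} → {Y : Set β // Y ∈ G}, IsCofinalMap F G f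

/-- `F ≡_T G`. -/
def TukeyEquiv {α β : Type*} (F : Filter α) (G : Filter β) : Prop :=
  TukeyLE F G ∧ TukeyLE G F

/-- `G ≤_RK F`: `G` is the image of `F` under a map between the base sets, that is,
`Y ∈ G ↔ f ⁻¹' Y ∈ F`. -/
def RudinKeislerLE {α β : Type*} (G : Filter β) (F : Filter α) : Prop :=
  ∃ f : α → β, G = Filter.map f F

def Nonprincipal (U : Ultrafilter ℕ) : Prop :=
  ∀ n : ℕ, ({n} : Set ℕ) ∉ U

/-- A p-point: a nonprincipal ultrafilter on `ℕ` in which every decreasing sequence of members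
has a pseudo-intersection. -/
def IsPPoint (U : Ultrafilter ℕ) : Prop :=
  Nonprincipal U ∧
    ∀ X : ℕ → Set ℕ, Antitone X → (∀ n, X n ∈ U) → ∃ A ∈ U, ∀ n, (A \ X n).Finite

/-- The Fubini product `lim_{n → U} V n` on `ℕ × ℕ`. -/
def fubiniProduct (U : Ultrafilter ℕ) (V : ℕ → Ultrafilter ℕ) : Ultrafilter (ℕ × ℕ) :=
  U.bind fun n => (V n).map (Prod.mk n)

theorem mem_fubiniProduct (U : Ultrafilter ℕ) (V : ℕ → Ultrafilter ℕ) (A : Set (ℕ × ℕ)) :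
    A ∈ fubiniProduct U V ↔ {n | {j | (n, j) ∈ A} ∈ V n} ∈ U :=
  Iff.rfl

/-- Countable iterates of Fubini products of p-points: the least class of ultrafilters that
contains the p-points and is closed under Fubini products over p-points. The base set `ℕ × ℕ`
of a product is identified with `ℕ` through an arbitrary bijection, so that the class consists
of all copies on `ℕ` of the iterates. -/
inductive IsFubiniIterate : Ultrafilter ℕ → Prop
  | pPoint (U : Ultrafilter ℕ) (hU : IsPPoint U) : IsFubiniIterate U
  | product (U : Ultrafilter ℕ) (hU : IsPPoint U) (V : ℕ → Ultrafilter ℕ)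
      (hV : ∀ n, IsFubiniIterate (V n)) (e : ℕ × ℕ ≃ ℕ) :
      IsFubiniIterate ((fubiniProduct U V).map e)

/-- A monotone cofinal map from `U` to `V`. -/
def IsMonotoneCofinal (U V : Ultrafilter ℕ)
    (h : {X : Set ℕ // X ∈ (U : Filter ℕ)} → {Y : Set ℕ // Y ∈ (V : Filter ℕ)}) : Prop :=
  Monotone h ∧ IsCofinalMap (U : Filter ℕ) (V : Filter ℕ) h

open Classical in
/-- `X ∩ k = X ∩ {0, …, k - 1}` as a finite set. -/
noncomputable def cut (X : Set ℕ) (k : ℕ) : Finset ℕ :=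
  (Finset.range k).filter (· ∈ X)

/-- `g : [ω]^{<ω} → [ω]^{<ω}` is monotone and generates `h` on some cofinal subset of `U`. -/
def FinitelyGenerates (U V : Ultrafilter ℕ) (g : Finset ℕ → Finset ℕ)
    (h : {X : Set ℕ // X ∈ (U : Filter ℕ)} → {Y : Set ℕ // Y ∈ (V : Filter ℕ)}) : Prop :=
  Monotone g ∧
    ∃ C : Set {X : Set ℕ // X ∈ (U : Filter ℕ)}, IsBase (U : Filter ℕ) C ∧
      ∀ X ∈ C, (h X).1 = ⋃ k : ℕ, (g (cut X.1 k) : Set ℕ)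

/-- `t ⊏ s`: `t` is a proper initial segment of `s` (with respect to the increasing
enumerations). -/
def ProperInitialSegment (t s : Finset ℕ) : Prop :=
  t ⊆ s ∧ t ≠ s ∧ ∀ y ∈ t, ∀ x ∈ s, x ≤ y → x ∈ t

/-- The `⊏`-minimal finite sets `s` with `g s ≠ ∅`. -/
def minimalSets (g : Finset ℕ → Finset ℕ) : Set (Finset ℕ) :=
  {s | g s ≠ ∅ ∧ ∀ t, ProperInitialSegment t s → g t = ∅}

/-- The filter `U(P)` on the base set `P`, generated by the sets `{s ∈ P : s ⊆ X}`, `X ∈ U`. -/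
def filterOn (U : Ultrafilter ℕ) (P : Set (Finset ℕ)) : Filter P where
  sets := {A | ∃ X ∈ U, {s : P | (s.1 : Set ℕ) ⊆ X} ⊆ A}
  univ_sets := ⟨Set.univ, Filter.univ_mem, Set.subset_univ _⟩
  sets_of_superset := by
    rintro A B ⟨X, hX, hA⟩ hAB
    exact ⟨X, hX, hA.trans hAB⟩
  inter_sets := by
    rintro A B ⟨X, hX, hA⟩ ⟨Y, hY, hB⟩
    exact ⟨X ∩ Y, Filter.inter_mem hX hY, fun s hs =>
      ⟨hA (Set.Subset.trans hs Set.inter_subset_left),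
        hB (Set.Subset.trans hs Set.inter_subset_right)⟩⟩

end TukeyFilters

open TukeyFilters

namespace TukeyFilters

/-! Everything rests on `HasFiniteCovers`, a property inherited along monotone coinitial maps. A
countable product of p-points has it (`hasFiniteCovers_productOrder`), such products map onto all
Fubini iterates, and hence every `U` Tukey below an iterate has it. For monotone `h`, apply it to
the upper sets `{X | n ∈ h X}`. If `n ∈ h X`, then `X` lies below none of the finitely many covering
sets outside; one point of `X` missing from each gives a finite part of `X` that forces `n` into `h
Y` for all `Y` in the coinitial set. So `h` is finitely generated there. Once `g ∅ = ∅`, the maps `X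
↦ {s ∈ P | s ⊆ X}` and `A ↦ ⋃ A` give the Tukey equivalence, and any choice of points `f s ∈ g s`
carries `U(P)` to `V`. -/

/-- For every sequence of upper sets there is a coinitial set `C` such that the part of `C`
outside each of them is covered by finitely many points outside of it. -/
def HasFiniteCovers (D : Type*) [Preorder D] : Prop :=
  ∀ H : ℕ → Set D, (∀ n, IsUpperSet (H n)) → ∃ C : Set D, (∀ x, ∃ c ∈ C, c ≤ x) ∧
    ∀ n, ∃ F : Set D, F.Finite ∧ (∀ y ∈ F, y ∉ H n) ∧ ∀ x ∈ C, x ∉ H n → ∃ y ∈ F, x ≤ y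

theorem HasFiniteCovers.of_monotone {D E : Type*} [Preorder D] [Preorder E]
    (hD : HasFiniteCovers D) (f : D → E) (hf : Monotone f) (hc : ∀ y, ∃ x, f x ≤ y) :
    HasFiniteCovers E := by
  intro H hH
  obtain ⟨C, hC, hF⟩ := hD (fun n => f ⁻¹' H n) fun n => (hH n).preimage hf
  refine ⟨f '' C, fun y => ?_, fun n => ?_⟩
  · obtain ⟨x, hx⟩ := hc y
    obtain ⟨c, hcC, hcx⟩ := hC x
    exact ⟨f c, ⟨c, hcC, rfl⟩, (hf hcx).trans hx⟩
  · obtain ⟨F, hfin, hout, hcov⟩ := hF n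
    refine ⟨f '' F, hfin.image f, ?_, ?_⟩
    · rintro _ ⟨y, hy, rfl⟩
      exact hout y hy
    · rintro _ ⟨x, hx, rfl⟩ hxn
      obtain ⟨y, hy, hxy⟩ := hcov x hx hxn
      exact ⟨f y, ⟨y, hy, rfl⟩, hf hxy⟩

theorem infinite_of_mem {U : Ultrafilter ℕ} (hU : Nonprincipal U) {X : Set ℕ} (hX : X ∈ U) :
    X.Infinite := by
  intro hfin
  obtain ⟨n, -, hn⟩ := U.eq_pure_of_finite_mem hfin hX
  exact hU n (by rw [hn]; exact Set.mem_singleton n)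

/-! ### Almost disjoint families and common gaps -/

/-- The set of codes of the finite initial pieces of `x`. -/
def branchCodes (x : Set ℕ) : Set ℕ :=
  Set.range fun n : ℕ => Encodable.encode (n, cut x n)

theorem mem_cut {X : Set ℕ} {k n : ℕ} : n ∈ cut X k ↔ n < k ∧ n ∈ X := by
  simp [cut]

theorem branchCodes_infinite (x : Set ℕ) : (branchCodes x).Infinite :=
  Set.infinite_range_of_injective fun _ _ h => (Prod.ext_iff.1 (Encodable.encode_injective h)).1

/-- Once `n` exceeds a point where `x` and `y` differ, their cuts at `n` differ. -/
theorem branchCodes_inter_finite {x y : Set ℕ} (h : x ≠ y) :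
    (branchCodes x ∩ branchCodes y).Finite := by
  obtain ⟨m, hm⟩ : ∃ m, ¬(m ∈ x ↔ m ∈ y) := by
    by_contra! hne
    exact h (Set.ext hne)
  refine ((Set.finite_Iic m).image fun n : ℕ => Encodable.encode (n, cut x n)).subset ?_
  rintro _ ⟨⟨n, rfl⟩, ⟨n', hn'⟩⟩
  refine ⟨n, ?_, rfl⟩
  have hpair := Prod.ext_iff.1 (Encodable.encode_injective hn')
  obtain rfl : n' = n := hpair.1
  have hcut : cut y n' = cut x n' := hpair.2
  by_contra hlt
  have hmn : m < n' := not_le.1 hlt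
  have h1 : m ∈ cut x n' ↔ m ∈ cut y n' := by rw [hcut]
  simp only [mem_cut, hmn, true_and] at h1
  exact hm h1

/-- Countably many nonprincipal ultrafilters omit a common infinite union of intervals
`[k, f k)`. -/
theorem exists_common_gaps (u : ℕ → Ultrafilter ℕ) (hu : ∀ t, Nonprincipal (u t)) (f : ℕ → ℕ) :
    ∃ K : Set ℕ, K.Infinite ∧ ∀ t, (⋃ k ∈ K, Set.Ico k (f k)) ∉ u t := by
  -- The intervals `[p i, f (p i))` are pairwise disjoint, so almost disjoint index sets have almost
  -- disjoint unions.
  let p : ℕ → ℕ := fun i => Nat.rec 0 (fun _ a => max (a + 1) (f a)) i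
  have hp : ∀ i, p (i + 1) = max (p i + 1) (f (p i)) := fun _ => rfl
  have hmono : StrictMono p := strictMono_nat_of_lt_succ fun i => by rw [hp]; omega
  have hf : ∀ i, f (p i) ≤ p (i + 1) := fun i => by rw [hp]; exact le_max_right _ _
  let G : Set ℕ → Set ℕ := fun x => ⋃ k ∈ p '' branchCodes x, Set.Ico k (f k)
  have hG : ∀ x y, x ≠ y → (G x ∩ G y).Finite := by
    intro x y hxy
    refine ((branchCodes_inter_finite hxy).biUnion fun i _ =>
      Set.finite_Ico (p i) (f (p i))).subset ?_
    rintro a ⟨hx, hy⟩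
    simp only [G, Set.mem_iUnion, Set.mem_image, exists_prop, exists_exists_and_eq_and,
      Set.mem_Ico] at hx hy
    obtain ⟨i, hi, h1, h2⟩ := hx
    obtain ⟨j, hj, h3, h4⟩ := hy
    have hij : i = j := by
      have h5 : i < j + 1 := hmono.lt_iff_lt.1 (h1.trans_lt (h4.trans_le (hf j)))
      have h6 : j < i + 1 := hmono.lt_iff_lt.1 (h3.trans_lt (h2.trans_le (hf i)))
      omega
    subst hij
    exact Set.mem_biUnion ⟨hi, hj⟩ ⟨h1, h2⟩
  by_contra! hcon
  have hall : ∀ x, ∃ t, G x ∈ u t := fun x =>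
    hcon (p '' branchCodes x) ((branchCodes_infinite x).image hmono.injective.injOn)
  choose F hF using hall
  -- A nonprincipal ultrafilter contains at most one member of an almost disjoint family, so `F`
  -- would inject the power set of `ℕ` into `ℕ`.
  refine Function.cantor_injective F fun x y hxy => ?_
  by_contra hne
  exact infinite_of_mem (hu (F x)) (Filter.inter_mem (hF x) (hxy ▸ hF y)) (hG x y hne)

/-! ### Countable products of p-points -/

/-- The pointwise ordered product of a sequence of ultrafilters. -/
abbrev ProductOrder (u : ℕ → Ultrafilter ℕ) : Type :=
  {A : ℕ → Set ℕ // ∀ t, A t ∈ u t}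

theorem hasFiniteCovers_productOrder (u : ℕ → Ultrafilter ℕ) (hu : ∀ t, IsPPoint (u t)) :
    HasFiniteCovers (ProductOrder u) := by
  classical
  intro H hH
  -- `R s n` is a chosen point outside `H n` that contains the finite trace `s`, if there is one.
  have hR : ∀ (s : Finset (ℕ × ℕ)) (n : ℕ), ∃ R : ProductOrder u,
      (∃ B : ProductOrder u, (∀ q ∈ s, q.2 ∈ B.1 q.1) ∧ B ∉ H n) →
        (∀ q ∈ s, q.2 ∈ R.1 q.1) ∧ R ∉ H n := by
    intro s n
    by_cases h : ∃ B : ProductOrder u, (∀ q ∈ s, q.2 ∈ B.1 q.1) ∧ B ∉ H n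
    · obtain ⟨B, hB⟩ := h
      exact ⟨B, fun _ => hB⟩
    · exact ⟨⟨fun _ => Set.univ, fun _ => Filter.univ_mem⟩, fun h' => absurd h' h⟩
  choose R hR using hR
  let box : ℕ → Finset (ℕ × ℕ) := fun k => Finset.range k ×ˢ Finset.range k
  let M : ℕ → ℕ → Set ℕ := fun t k =>
    ⋂ s ∈ (box k).powerset, ⋂ n ∈ Finset.range (k + 1), (R s n).1 t
  have hM_mem : ∀ t k, M t k ∈ u t := fun t k =>
    (Filter.biInter_finset_mem _).2 fun s _ =>
      (Filter.biInter_finset_mem _).2 fun n _ => (R s n).2 t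
  have hM_sub : ∀ t k s n, s ⊆ box k → n ≤ k → M t k ⊆ (R s n).1 t := by
    intro t k s n hs hn j hj
    simp only [M, Set.mem_iInter] at hj
    exact hj s (Finset.mem_powerset.2 hs) n (by simpa [Nat.lt_succ_iff] using hn)
  have hM_anti : ∀ t, Antitone (M t) := by
    intro t k l hkl j hj
    simp only [M, Set.mem_iInter] at hj ⊢
    intro s hs n hn
    refine hj s ?_ n ?_
    · exact Finset.mem_powerset.2 ((Finset.mem_powerset.1 hs).trans
        (Finset.product_subset_product (Finset.range_mono hkl) (Finset.range_mono hkl)))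
    · exact Finset.range_mono (by omega) hn
  choose B hBmem hBfin using fun t => (hu t).2 (M t) (hM_anti t) (hM_mem t)
  have hbound : ∀ t k, ∃ b, ∀ j ∈ B t, b ≤ j → j ∈ M t k := by
    intro t k
    obtain ⟨b, hb⟩ := (hBfin t k).bddAbove
    refine ⟨b + 1, fun j hj hbj => ?_⟩
    by_contra hjM
    have := hb ⟨hj, hjM⟩
    omega
  choose b hb using hbound
  -- Beyond `f k`, the first `k` coordinates of `B` lie in `M · k`; removing the gaps `[k, f k)`
  -- makes this hold already beyond `k`.
  let f : ℕ → ℕ := fun k => (Finset.range k).sup fun t => b t k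
  obtain ⟨K, hKinf, hK⟩ := exists_common_gaps u (fun t => (hu t).1) f
  -- `M t t` handles the coordinates `t ≥ k`, the gaps those with `t < k`.
  let A : ProductOrder u := ⟨fun t => B t ∩ M t t ∩ (⋃ k ∈ K, Set.Ico k (f k))ᶜ, fun t =>
    Filter.inter_mem (Filter.inter_mem (hBmem t) (hM_mem t t))
      (Ultrafilter.compl_mem_iff_notMem.2 (hK t))⟩
  have hA : ∀ k ∈ K, ∀ t j, j ∈ A.1 t → (k ≤ t ∨ k ≤ j) → j ∈ M t k := by
    rintro k hk t j ⟨⟨hjB, hjM⟩, hjG⟩ hkj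
    rcases le_or_gt k t with hkt | hkt
    · exact hM_anti t hkt hjM
    · have hkj' : k ≤ j := by omega
      have hfj : f k ≤ j := by
        by_contra hlt
        exact hjG (Set.mem_biUnion hk ⟨hkj', not_le.1 hlt⟩)
      refine hb t k j hjB (le_trans ?_ hfj)
      exact Finset.le_sup (f := fun t => b t k) (Finset.mem_range.2 hkt)
  refine ⟨{X | X ≤ A}, fun X => ?_, fun n => ?_⟩
  · exact ⟨⟨fun t => X.1 t ∩ A.1 t, fun t => Filter.inter_mem (X.2 t) (A.2 t)⟩,
      fun t => Set.inter_subset_right, fun t => Set.inter_subset_left⟩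
  · obtain ⟨k, hk, hnk⟩ := hKinf.exists_gt n
    refine ⟨{Y | (∃ s ∈ (box k).powerset, R s n = Y) ∧ Y ∉ H n}, ?_, fun Y hY => hY.2, ?_⟩
    · exact (((box k).powerset.finite_toSet).image fun s => R s n).subset fun Y hY => hY.1
    · intro X hXA hXn
      -- `X ≤ R s n`: inside the box because `R s n` contains the trace `s`, outside because `A`
      -- lies in `M · k` there.
      let s := (box k).filter fun q => q.2 ∈ X.1 q.1
      have hs : s ⊆ box k := Finset.filter_subset _ _
      obtain ⟨hsR, hRn⟩ := hR s n ⟨X, fun q hq => (Finset.mem_filter.1 hq).2, hXn⟩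
      refine ⟨R s n, ⟨⟨s, Finset.mem_powerset.2 hs, rfl⟩, hRn⟩, fun t j hj => ?_⟩
      by_cases hin : t < k ∧ j < k
      · exact hsR (t, j) (Finset.mem_filter.2 ⟨by simpa [box] using hin, hj⟩)
      · exact hM_sub t k s n hs hnk.le (hA k hk t j (hXA t hj) (by omega))

/-! ### Reduction of iterates to products -/

/-- Every Fubini iterate of p-points is a monotone cofinal image of a countable product of
p-points. -/
theorem IsFubiniIterate.exists_productOrder {W : Ultrafilter ℕ} (hW : IsFubiniIterate W) :
    ∃ u : ℕ → Ultrafilter ℕ, (∀ t, IsPPoint (u t)) ∧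
      ∃ φ : ProductOrder u → {X : Set ℕ // X ∈ (W : Filter ℕ)},
        Monotone φ ∧ ∀ X, ∃ A, φ A ≤ X := by
  induction hW with
  | pPoint U hU =>
    exact ⟨fun _ => U, fun _ => hU, fun A => ⟨A.1 0, A.2 0⟩, fun A B h => h 0,
      fun X => ⟨⟨fun _ => X.1, fun _ => X.2⟩, le_rfl⟩⟩
  | product U hU V hV e ih =>
    choose v hv φ hφ hcof using ih
    -- Index `0` carries `U`; index `Nat.pair n m + 1` carries the `m`-th factor for `V n`.
    let u : ℕ → Ultrafilter ℕ := fun t =>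
      Nat.casesOn t U fun m => v m.unpair.1 m.unpair.2
    have hu_pair : ∀ n m, u (Nat.pair n m + 1) = v n m := fun n m => by simp [u]
    let sec : ProductOrder u → ∀ n, ProductOrder (v n) := fun A n =>
      ⟨fun m => A.1 (Nat.pair n m + 1), fun m => hu_pair n m ▸ A.2 (Nat.pair n m + 1)⟩
    let Φ : ProductOrder u → Set ℕ := fun A =>
      e '' {q | q.1 ∈ A.1 0 ∧ q.2 ∈ (φ q.1 (sec A q.1)).1}
    have hmem : ∀ A, Φ A ∈ (fubiniProduct U V).map e := by
      intro A
      rw [Ultrafilter.mem_map, Set.preimage_image_eq _ e.injective, mem_fubiniProduct]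
      refine Filter.mem_of_superset (A.2 0) fun n hn => ?_
      exact Filter.mem_of_superset (φ n (sec A n)).2 fun j hj => ⟨hn, hj⟩
    refine ⟨u, ?_, fun A => ⟨Φ A, hmem A⟩, ?_, ?_⟩
    · rintro (_ | m)
      · exact hU
      · exact hv _ _
    · intro A B hAB
      refine Set.image_mono ?_
      rintro ⟨n, j⟩ ⟨hn, hj⟩
      exact ⟨hAB 0 hn, hφ n (fun m => hAB (Nat.pair n m + 1)) hj⟩
    · rintro ⟨X, hX⟩
      have hX' : {n | {j | e (n, j) ∈ X} ∈ V n} ∈ U := hX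
      have hch : ∀ n, ∃ A : ProductOrder (v n),
          {j | e (n, j) ∈ X} ∈ V n → (φ n A).1 ⊆ {j | e (n, j) ∈ X} := by
        intro n
        by_cases hn : {j | e (n, j) ∈ X} ∈ V n
        · obtain ⟨A, hA⟩ := hcof n ⟨_, hn⟩
          exact ⟨A, fun _ => hA⟩
        · exact ⟨⟨fun _ => Set.univ, fun _ => Filter.univ_mem⟩, fun h => absurd h hn⟩
      choose A hA using hch
      let A' : ProductOrder u := ⟨fun t => Nat.casesOn t {n | {j | e (n, j) ∈ X} ∈ V n}
        fun m => (A m.unpair.1).1 m.unpair.2, by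
          rintro (_ | m)
          · exact hX'
          · exact (A m.unpair.1).2 m.unpair.2⟩
      have hsec : ∀ n, sec A' n = A n := by
        intro n
        ext m : 2
        change (A (Nat.pair n m).unpair.1).1 (Nat.pair n m).unpair.2 = (A n).1 m
        rw [Nat.unpair_pair]
      refine ⟨A', ?_⟩
      rintro _ ⟨⟨n, j⟩, ⟨hn, hj⟩, rfl⟩
      rw [hsec] at hj
      exact hA n hn hj

/-! ### Monotone cofinal maps -/

theorem IsCofinalMap.of_monotone {α β : Type*} {F : Filter α} {G : Filter β}
    {f : {X : Set α // X ∈ F} → {Y : Set β // Y ∈ G}} (hf : Monotone f)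
    (hc : ∀ Y, ∃ X, f X ≤ Y) : IsCofinalMap F G f := by
  intro C hC Y hY
  obtain ⟨X, hX⟩ := hc ⟨Y, hY⟩
  obtain ⟨B, hB, hBX⟩ := hC X.1 X.2
  exact ⟨f B, ⟨B, hB, rfl⟩, le_trans (hf hBX) hX⟩

theorem IsCofinalMap.exists_le {α β : Type*} {F : Filter α} {G : Filter β}
    {f : {X : Set α // X ∈ F} → {Y : Set β // Y ∈ G}} (hf : IsCofinalMap F G f) (Y : Set β)
    (hY : Y ∈ G) : ∃ X, ∀ X', X' ≤ X → (f X').1 ⊆ Y := by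
  by_contra! hcon
  obtain ⟨_, ⟨X, hX, rfl⟩, hXY⟩ := hf {X | ¬(f X).1 ⊆ Y}
    (fun X hX => by
      obtain ⟨X', hle, hX'⟩ := hcon ⟨X, hX⟩
      exact ⟨X', hX', hle⟩) Y hY
  exact hX hXY

/-- Replace `f X` by the union of all `f X'` with `X' ≤ X`; cofinality of `f` bounds this union for
small `X`. -/
theorem TukeyLE.exists_monotone {α β : Type*} {F : Filter α} {G : Filter β}
    (h : TukeyLE G F) : ∃ f : {X : Set α // X ∈ F} → {Y : Set β // Y ∈ G},
      Monotone f ∧ IsCofinalMap F G f := by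
  obtain ⟨f, hf⟩ := h
  let φ : {X : Set α // X ∈ F} → {Y : Set β // Y ∈ G} := fun X =>
    ⟨⋃ X' ∈ Set.Iic X, (f X').1, Filter.mem_of_superset (f X).2
      (Set.subset_biUnion_of_mem (u := fun X' => (f X').1) (Set.mem_Iic.2 le_rfl))⟩
  have hφ : Monotone φ := fun X Y hXY => Set.biUnion_mono (Set.Iic_subset_Iic.2 hXY)
    fun _ _ => subset_rfl
  refine ⟨φ, hφ, IsCofinalMap.of_monotone hφ fun Y => ?_⟩
  obtain ⟨X, hX⟩ := hf.exists_le Y.1 Y.2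
  exact ⟨X, Set.iUnion₂_subset hX⟩

theorem IsCofinalMap.exists_apply_le {α β : Type*} {F : Filter α} {G : Filter β}
    {f : {X : Set α // X ∈ F} → {Y : Set β // Y ∈ G}} (hf : IsCofinalMap F G f)
    (Y : {Y : Set β // Y ∈ G}) : ∃ X, f X ≤ Y := by
  obtain ⟨X, hX⟩ := hf.exists_le Y.1 Y.2
  exact ⟨X, hX X le_rfl⟩

theorem hasFiniteCovers_of_tukeyLE {W U : Ultrafilter ℕ} (hW : IsFubiniIterate W)
    (hU : TukeyLE (U : Filter ℕ) (W : Filter ℕ)) :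
    HasFiniteCovers {X : Set ℕ // X ∈ (U : Filter ℕ)} := by
  obtain ⟨u, hu, φ, hφ, hφc⟩ := hW.exists_productOrder
  obtain ⟨f, hf, hfc⟩ := hU.exists_monotone
  exact ((hasFiniteCovers_productOrder u hu).of_monotone φ hφ hφc).of_monotone f hf
    hfc.exists_apply_le

/-! ### Finite generation -/

theorem cut_subset (X : Set ℕ) (k : ℕ) : (cut X k : Set ℕ) ⊆ X :=
  fun _ h => (mem_cut.1 h).2

theorem cut_mono (X : Set ℕ) : Monotone (cut X) :=
  fun _ _ h _ hn => mem_cut.2 ⟨(mem_cut.1 hn).1.trans_le h, (mem_cut.1 hn).2⟩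

theorem exists_subset_cut {X : Set ℕ} {s : Finset ℕ} (hs : (s : Set ℕ) ⊆ X) :
    ∃ k, s ⊆ cut X k :=
  ⟨s.sup id + 1, fun _ hn => mem_cut.2 ⟨Nat.lt_succ_of_le (Finset.le_sup (f := id) hn), hs hn⟩⟩

theorem exists_le_card_cut {X : Set ℕ} (hX : X.Infinite) (n : ℕ) : ∃ k, n ≤ (cut X k).card := by
  obtain ⟨s, hs, hcard⟩ := hX.exists_subset_card_eq n
  obtain ⟨k, hk⟩ := exists_subset_cut hs
  exact ⟨k, hcard ▸ Finset.card_le_card hk⟩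

variable {U V : Ultrafilter ℕ}
  {h : {X : Set ℕ // X ∈ (U : Filter ℕ)} → {Y : Set ℕ // Y ∈ (V : Filter ℕ)}}

/-- A generating function can be taken to vanish at the empty set. -/
theorem FinitelyGenerates.exists_empty {g : Finset ℕ → Finset ℕ}
    (hg : FinitelyGenerates U V g h) :
    ∃ g' : Finset ℕ → Finset ℕ, FinitelyGenerates U V g' h ∧ g' ∅ = ∅ := by
  classical
  obtain ⟨hmono, C, hC, hgen⟩ := hg
  refine ⟨fun s => if s = ∅ then ∅ else g s, ⟨?_, C, hC, fun X hX => ?_⟩, if_pos rfl⟩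
  · intro s t hst
    by_cases hs : s = ∅
    · simp [hs]
    · have ht : t ≠ ∅ := fun ht => hs (Finset.subset_empty.1 (ht ▸ hst))
      simpa [hs, ht] using hmono hst
  · rw [hgen X hX]
    refine Set.Subset.antisymm (Set.iUnion_subset fun k n hn => ?_)
      (Set.iUnion_mono fun k n hn => ?_)
    · obtain ⟨x, hx⟩ := U.nonempty_of_mem X.2
      have hne : cut X.1 (max k (x + 1)) ≠ ∅ :=
        Finset.ne_empty_of_mem (mem_cut.2 ⟨by omega, hx⟩)
      refine Set.mem_iUnion.2 ⟨max k (x + 1), ?_⟩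
      simp only [if_neg hne]
      exact hmono (cut_mono X.1 (le_max_left _ _)) hn
    · by_cases hc : cut X.1 k = ∅
      · simp [hc] at hn
      · simpa [hc] using hn

/-- `{m}` is the least member of `U`, so `h {m}` is the least member of `V`, a singleton. -/
theorem exists_finitelyGenerates_of_pure {m : ℕ} (hm : ({m} : Set ℕ) ∈ U)
    (hh : IsMonotoneCofinal U V h) : ∃ g, FinitelyGenerates U V g h := by
  classical
  let X₀ : {X : Set ℕ // X ∈ (U : Filter ℕ)} := ⟨{m}, hm⟩
  have hmin : ∀ X : {X : Set ℕ // X ∈ (U : Filter ℕ)}, m ∈ X.1 := by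
    intro X
    obtain ⟨x, hx, hxm⟩ := U.nonempty_of_mem (Filter.inter_mem X.2 hm)
    rwa [← Set.mem_singleton_iff.1 hxm]
  have hle : ∀ Y ∈ V, (h X₀).1 ⊆ Y := by
    intro Y hY
    obtain ⟨X, hX⟩ := hh.2.exists_apply_le ⟨Y, hY⟩
    exact (hh.1 (show X₀ ≤ X from Set.singleton_subset_iff.2 (hmin X))).trans hX
  obtain ⟨p, hp⟩ := V.nonempty_of_mem (h X₀).2
  have hpV : ({p} : Set ℕ) ∈ V := by
    by_contra hn
    exact hle _ (Ultrafilter.compl_mem_iff_notMem.2 hn) hp rfl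
  have heq : (h X₀).1 = {p} :=
    Set.Subset.antisymm (hle _ hpV) (Set.singleton_subset_iff.2 hp)
  refine ⟨fun s => if m ∈ s then {p} else ∅, ?_, {X₀}, ?_, ?_⟩
  · intro s t hst
    by_cases hs : m ∈ s
    · simp [hs, hst hs]
    · simp [hs]
  · exact fun X hX => ⟨X₀, rfl, Set.singleton_subset_iff.2 (hmin ⟨X, hX⟩)⟩
  · rintro _ rfl
    rw [heq]
    refine Set.Subset.antisymm ?_ (Set.iUnion_subset fun k => ?_)
    · refine Set.singleton_subset_iff.2 (Set.mem_iUnion.2 ⟨m + 1, ?_⟩)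
      have : m ∈ cut X₀.1 (m + 1) := mem_cut.2 ⟨Nat.lt_succ_self m, rfl⟩
      simp [this]
    · dsimp only
      split_ifs <;> simp

theorem exists_finitelyGenerates (hU : HasFiniteCovers {X : Set ℕ // X ∈ (U : Filter ℕ)})
    (hh : IsMonotoneCofinal U V h) : ∃ g, FinitelyGenerates U V g h := by
  classical
  by_cases hnp : Nonprincipal U
  swap
  · simp only [Nonprincipal, not_forall, not_not] at hnp
    obtain ⟨m, hm⟩ := hnp
    exact exists_finitelyGenerates_of_pure hm hh
  obtain ⟨C, hC, hcov⟩ := hU (fun n => {X | n ∈ (h X).1}) fun n X Y hXY hX => hh.1 hXY hX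
  have hfin : ∀ X n, n ∈ (h X).1 →
      ∃ s : Finset ℕ, (s : Set ℕ) ⊆ X.1 ∧ ∀ Y ∈ C, (s : Set ℕ) ⊆ Y.1 → n ∈ (h Y).1 := by
    intro X n hn
    obtain ⟨F, hF, hout, hFC⟩ := hcov n
    have hz : ∀ Y ∈ F, ∃ z ∈ X.1, z ∉ Y.1 := by
      intro Y hY
      by_contra! hsub
      exact hout Y hY (hh.1 (show X ≤ Y from hsub) hn)
    choose! z hzX hzY using hz
    refine ⟨hF.toFinset.image z, ?_, fun Y hY hsY => ?_⟩
    · intro a ha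
      obtain ⟨Z, hZ, rfl⟩ := Finset.mem_image.1 (Finset.mem_coe.1 ha)
      exact hzX Z (hF.mem_toFinset.1 hZ)
    · by_contra hnY
      obtain ⟨Z, hZ, hYZ⟩ := hFC Y hY hnY
      exact hzY Z hZ (hYZ (hsY (Finset.mem_coe.2
        (Finset.mem_image_of_mem z (hF.mem_toFinset.2 hZ)))))
  -- The bound `n < s.card` keeps values finite and monotone in `s`; it is harmless since members of
  -- `U` are infinite.
  refine ⟨fun s => (Finset.range s.card).filter fun n =>
    ∀ Y ∈ C, (s : Set ℕ) ⊆ Y.1 → n ∈ (h Y).1, ?_, C, fun X hX => hC ⟨X, hX⟩, fun X hX => ?_⟩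
  · intro s t hst n hn
    rw [Finset.mem_filter, Finset.mem_range] at hn ⊢
    exact ⟨hn.1.trans_le (Finset.card_le_card hst), fun Y hY htY =>
      hn.2 Y hY ((Finset.coe_subset.2 hst).trans htY)⟩
  · refine Set.Subset.antisymm (fun n hn => ?_) (Set.iUnion_subset fun k n hn => ?_)
    · obtain ⟨s, hsX, hs⟩ := hfin X n hn
      obtain ⟨k, hk⟩ := exists_subset_cut hsX
      obtain ⟨l, hl⟩ := exists_le_card_cut (infinite_of_mem hnp X.2) (n + 1)
      refine Set.mem_iUnion.2 ⟨max k l, Finset.mem_coe.2 (Finset.mem_filter.2 ⟨?_, ?_⟩)⟩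
      · have := Finset.card_le_card (cut_mono X.1 (le_max_right k l))
        exact Finset.mem_range.2 (by omega)
      · exact fun Y hY hY' => hs Y hY ((Finset.coe_subset.2
          (hk.trans (cut_mono X.1 (le_max_left k l)))).trans hY')
    · exact (Finset.mem_filter.1 (Finset.mem_coe.1 hn)).2 X hX (cut_subset X.1 k)

/-! ### The filter on minimal sets -/

theorem ProperInitialSegment.eq_cut {t : Finset ℕ} {X : Set ℕ} {k : ℕ}
    (ht : ProperInitialSegment t (cut X k)) : ∃ l < k, t = cut X l := by
  obtain ⟨hsub, hne, hinit⟩ := ht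
  obtain ⟨x, hx, hxt⟩ : ∃ x ∈ cut X k, x ∉ t := by
    by_contra! hall
    exact hne (Finset.Subset.antisymm hsub hall)
  have hex : ∃ x, x ∈ cut X k ∧ x ∉ t := ⟨x, hx, hxt⟩
  classical
  obtain ⟨hmem, hnot⟩ := Nat.find_spec hex
  refine ⟨Nat.find hex, (mem_cut.1 hmem).1, ?_⟩
  ext y
  refine ⟨fun hy => mem_cut.2 ⟨?_, (mem_cut.1 (hsub hy)).2⟩, fun hy => ?_⟩
  · by_contra hle
    exact hnot (hinit y hy _ hmem (not_lt.1 hle))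
  · obtain ⟨hlt, hyX⟩ := mem_cut.1 hy
    by_contra hyt
    exact Nat.find_min hex hlt
      ⟨mem_cut.2 ⟨hlt.trans (mem_cut.1 hmem).1, hyX⟩, hyt⟩

theorem exists_minimalSets_subset {g : Finset ℕ → Finset ℕ} (hg : FinitelyGenerates U V g h)
    {X : Set ℕ} (hX : X ∈ U) : ∃ s ∈ minimalSets g, (s : Set ℕ) ⊆ X := by
  classical
  obtain ⟨hmono, C, hC, hgen⟩ := hg
  obtain ⟨B, hB, hBX⟩ := hC X hX
  have hex : ∃ k, g (cut B.1 k) ≠ ∅ := by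
    obtain ⟨n, hn⟩ := V.nonempty_of_mem (h B).2
    rw [hgen B hB] at hn
    obtain ⟨k, hk⟩ := Set.mem_iUnion.1 hn
    exact ⟨k, Finset.ne_empty_of_mem hk⟩
  refine ⟨cut B.1 (Nat.find hex), ⟨Nat.find_spec hex, fun t ht => ?_⟩,
    (cut_subset _ _).trans hBX⟩
  obtain ⟨l, hl, rfl⟩ := ht.eq_cut
  exact not_not.1 (Nat.find_min hex hl)

/-- If `s ⊆ X` with `X` in the generating base, then `f s ∈ g s ⊆ h X`. So the image filter contains
`V`; being proper, it equals `V`. -/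
theorem rudinKeislerLE_filterOn {g : Finset ℕ → Finset ℕ} (hg : FinitelyGenerates U V g h)
    (hh : IsMonotoneCofinal U V h) :
    RudinKeislerLE (V : Filter ℕ) (filterOn U (minimalSets g)) := by
  choose f hf using fun s : minimalSets g => Finset.nonempty_iff_ne_empty.2 s.2.1
  have hne : (filterOn U (minimalSets g)).NeBot := by
    refine Filter.neBot_iff.2 fun hbot => ?_
    obtain ⟨X, hX, hsub⟩ : ∅ ∈ filterOn U (minimalSets g) := Filter.empty_mem_iff_bot.2 hbot
    obtain ⟨s, hs, hsX⟩ := exists_minimalSets_subset hg hX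
    exact hsub (show (⟨s, hs⟩ : minimalSets g) ∈ _ from hsX)
  refine ⟨f, (V.unique (fun Y hY => ?_) (hne.map f)).symm⟩
  obtain ⟨hmono, C, hC, hgen⟩ := hg
  obtain ⟨_, ⟨X, hX, rfl⟩, hXY⟩ := hh.2 C hC Y hY
  refine ⟨X.1, X.2, fun s hs => hXY ?_⟩
  rw [hgen X hX]
  obtain ⟨k, hk⟩ := exists_subset_cut hs
  exact Set.mem_iUnion.2 ⟨k, hmono hk (hf s)⟩

theorem tukeyEquiv_filterOn {g : Finset ℕ → Finset ℕ} (hg : FinitelyGenerates U V g h)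
    (h0 : g ∅ = ∅) : TukeyEquiv (filterOn U (minimalSets g)) (U : Filter ℕ) := by
  constructor
  · refine ⟨fun X => ⟨{s | (s.1 : Set ℕ) ⊆ X.1}, X.1, X.2, subset_rfl⟩,
      IsCofinalMap.of_monotone (fun X Y hXY s hs => Set.Subset.trans hs hXY) ?_⟩
    rintro ⟨A, X, hX, hXA⟩
    exact ⟨⟨X, hX⟩, hXA⟩
  · have hmem : ∀ A ∈ filterOn U (minimalSets g), (⋃ s ∈ A, (s.1 : Set ℕ)) ∈ U := by
      rintro A ⟨X, hX, hXA⟩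
      -- Otherwise some minimal set inside `X` avoids the union, yet it belongs to `A` and is
      -- nonempty by `h0`.
      by_contra hn
      obtain ⟨s, hs, hsX⟩ := exists_minimalSets_subset hg
        (Filter.inter_mem hX (Ultrafilter.compl_mem_iff_notMem.2 hn))
      obtain ⟨a, ha⟩ : s.Nonempty := by
        rw [Finset.nonempty_iff_ne_empty]
        rintro rfl
        exact hs.1 h0
      have hsA : (⟨s, hs⟩ : minimalSets g) ∈ A := hXA fun b hb => (hsX hb).1
      exact (hsX ha).2 (Set.mem_biUnion hsA ha)
    refine ⟨fun A => ⟨⋃ s ∈ A.1, (s.1 : Set ℕ), hmem A.1 A.2⟩,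
      IsCofinalMap.of_monotone (fun A B hAB => Set.biUnion_subset_biUnion_left hAB) ?_⟩
    rintro ⟨X, hX⟩
    exact ⟨⟨{s | (s.1 : Set ℕ) ⊆ X}, X, hX, subset_rfl⟩, Set.iUnion₂_subset fun s hs => hs⟩

/-- A point of `g ∅` would lie in every generated `h X`, hence in every member of `V`. -/
theorem FinitelyGenerates.apply_empty {g : Finset ℕ → Finset ℕ}
    (hg : FinitelyGenerates U V g h) (hh : IsMonotoneCofinal U V h) (hV : Nonprincipal V) :
    g ∅ = ∅ := by
  obtain ⟨hmono, C, hC, hgen⟩ := hg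
  refine Finset.eq_empty_of_forall_notMem fun n hn => ?_
  obtain ⟨_, ⟨X, hX, rfl⟩, hXn⟩ := hh.2 C hC {n}ᶜ (Ultrafilter.compl_mem_iff_notMem.2 (hV n))
  refine hXn ?_ rfl
  rw [hgen X hX]
  exact Set.mem_iUnion.2 ⟨0, hmono (Finset.empty_subset _) hn⟩

end TukeyFilters

theorem theorem6p4 (W U V : Ultrafilter ℕ) (hW : IsFubiniIterate W)
    (hU : TukeyLE (U : Filter ℕ) (W : Filter ℕ))
    (hV : TukeyLE (V : Filter ℕ) (U : Filter ℕ)) :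
    (∃ h, IsMonotoneCofinal U V h) ∧
    ∀ h, IsMonotoneCofinal U V h →
      (∃ g : Finset ℕ → Finset ℕ, FinitelyGenerates U V g h ∧
        TukeyEquiv (filterOn U (minimalSets g)) (U : Filter ℕ) ∧
        RudinKeislerLE (V : Filter ℕ) (filterOn U (minimalSets g))) ∧
      (Nonprincipal V → ∀ g : Finset ℕ → Finset ℕ, FinitelyGenerates U V g h →
        TukeyEquiv (filterOn U (minimalSets g)) (U : Filter ℕ) ∧
        RudinKeislerLE (V : Filter ℕ) (filterOn U (minimalSets g))) := by
  refine ⟨hV.exists_monotone, fun h hh => ⟨?_, fun hnp g hg => ?_⟩⟩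
  · obtain ⟨g, hg⟩ := exists_finitelyGenerates (hasFiniteCovers_of_tukeyLE hW hU) hh
    obtain ⟨g', hg', h0⟩ := hg.exists_empty
    exact ⟨g', hg', tukeyEquiv_filterOn hg' h0, rudinKeislerLE_filterOn hg' hh⟩
  · exact ⟨tukeyEquiv_filterOn hg (hg.apply_empty hh hnp), rudinKeislerLE_filterOn hg hh⟩
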